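/- Let $N\ge 3$. Let $V:(0,+\infty)\to[0,+\infty]$ be measurable, finite almost everywhere, with $V\in L^1((r_1,r_2))$ for some $r_2>r_1>0$, and let $K:(0,+\infty)\to(0,+\infty)$ be measurable with $K\in L^s_{\mathrm{loc}}((0,+\infty))$ for some $s>\frac{2N}{N+2}$. Let $D^{1,2}(\mathbb R^N)=\{u\in L^{2N/(N-2)}(\mathbb R^N):\nabla u\in L^2(\mathbb R^N)\}$ and $$H^1_V=\Big\{u\in D^{1,2}(\mathbb R^N):\int_{\mathbb R^N}V(|x|)u^2\,dx<\infty\Big\},\qquad \|u\|^2=\int_{\mathbb R^N}\big(|\nabla u|^2+V(|x|)u^2\big)\,dx,$$ and let $H^1_{V,\mathrm r}$ be the closure in $H^1_V$ of the set of radial $u\in C^\infty_{\mathrm c}(\mathbb R^N)$ with $\int_{\mathbb R^N} V(|x|)u^2\,dx<\infty$. For $q>1$ and $R>0$ set $$\mathcal R_\infty(q,R)=\sup_{u\in H^1_{V,\mathrm r},\ h\in H^1_V,\ \|u\|=\|h\|=1}\ \int_{\{|x|\ge R\}}K(|x|)\,|u|^{q-1}|h|\,dx\in[0,+\infty].$$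 Assume that there are $R_2>0$, $0\le\beta_\infty\le1$, $\alpha_\infty\in\mathbb R$ and $\gamma_\infty\le2$ such that $$\operatorname*{ess\,sup}_{r>R_2}\frac{K(r)}{r^{\alpha_\infty}V(r)^{\beta_\infty}}<+\infty\qquad\text{and}\qquad \operatorname*{ess\,inf}_{r>R_2}\,r^{\gamma_\infty}V(r)>0,$$ with the convention $V(r)^0=1$. Then $\lim_{R\to+\infty}\mathcal R_\infty(q_2,R)=0$ for every $q_2\in\mathbb R$ with $q_2>\max\{1,2\beta_\infty,q_*,q_{**}\}$, where $$q_*=2\,\frac{\alpha_\infty-\gamma_\infty\beta_\infty+N}{N-\gamma_\infty},\qquad q_{**}=2\,\frac{2\alpha_\infty+(1-2\beta_\infty)\gamma_\infty+2(N-1)}{2(N-1)-\gamma_\infty}.$$ -/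

import Mathlib

open MeasureTheory Filter Topology Set
open scoped ENNReal

namespace RadialSobolev

/-- The space `ℝ^N` with its Euclidean norm. -/
abbrev E (N : ℕ) : Type := EuclideanSpace ℝ (Fin N)

/-- Real `C^∞` functions with compact support in `ℝ^N`. -/
def IsTestFunction {N : ℕ} (φ : E N → ℝ) : Prop :=
  ContDiff ℝ (⊤ : ℕ∞) φ ∧ HasCompactSupport φ

/-- `u` is radial: its value at `x` depends on `‖x‖` only. -/
def IsRadial {N : ℕ} (u : E N → ℝ) : Prop :=
  ∀ x y : E N, ‖x‖ = ‖y‖ → u x = u y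

/-- `G` is the distributional gradient of `u` on `ℝ^N`. -/
def HasWeakGradient {N : ℕ} (u : E N → ℝ) (G : E N → E N) : Prop :=
  LocallyIntegrable u volume ∧ LocallyIntegrable G volume ∧
    ∀ φ : E N → ℝ, IsTestFunction φ → ∀ v : E N,
      ∫ x, u x * fderiv ℝ φ x v = - ∫ x, inner ℝ (G x) v * φ x

open Classical in
/-- The weak gradient of `u` (determined up to null sets; `0` if there is none). -/
noncomputable def weakGradient {N : ℕ} (u : E N → ℝ) : E N → E N :=
  if h : ∃ G : E N → E N, HasWeakGradient u G then h.choose else 0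

/-- `u ∈ D^{1,2}(ℝ^N)`: `u ∈ L^{2^*}`, `2^* = 2N/(N-2)`, with weak gradient in `L^2`. -/
def MemD12 {N : ℕ} (u : E N → ℝ) : Prop :=
  MemLp u (ENNReal.ofReal (2 * (N : ℝ) / ((N : ℝ) - 2))) volume ∧
    (∃ G : E N → E N, HasWeakGradient u G) ∧ MemLp (weakGradient u) 2 volume

/-- `∫ V(|x|) u² dx`. -/
noncomputable def potentialEnergy {N : ℕ} (V : ℝ → ℝ≥0∞) (u : E N → ℝ) : ℝ≥0∞ :=
  ∫⁻ x, V ‖x‖ * ‖u x‖ₑ ^ 2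

/-- `‖u‖ = (∫ (|∇u|² + V(|x|) u²) dx)^{1/2}`. -/
noncomputable def hNorm {N : ℕ} (V : ℝ → ℝ≥0∞) (u : E N → ℝ) : ℝ≥0∞ :=
  (∫⁻ x, (‖weakGradient u x‖ₑ ^ 2 + V ‖x‖ * ‖u x‖ₑ ^ 2)) ^ (1 / 2 : ℝ)

/-- `u ∈ H^1_V`. -/
def MemH {N : ℕ} (V : ℝ → ℝ≥0∞) (u : E N → ℝ) : Prop :=
  MemD12 u ∧ potentialEnergy V u < ∞

/-- `u ∈ H^1_{V,r}`: the closure in `H^1_V` of the radial test functions of finite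
potential energy. -/
def MemHrad {N : ℕ} (V : ℝ → ℝ≥0∞) (u : E N → ℝ) : Prop :=
  MemH V u ∧ ∀ ε : ℝ≥0∞, 0 < ε →
    ∃ φ : E N → ℝ, IsTestFunction φ ∧ IsRadial φ ∧ potentialEnergy V φ < ∞ ∧
      hNorm V (u - φ) < ε

/-- `𝓡_∞(q, R)`, with values in `[0, ∞]`. -/
noncomputable def Rinfty (N : ℕ) (V : ℝ → ℝ≥0∞) (K : ℝ → ℝ) (q R : ℝ) : ℝ≥0∞ :=
  ⨆ (u : E N → ℝ) (h : E N → ℝ) (_ : MemHrad V u) (_ : MemH V h)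
    (_ : hNorm V u = 1) (_ : hNorm V h = 1),
    ∫⁻ x in (Metric.ball (0 : E N) R)ᶜ,
      ENNReal.ofReal (K ‖x‖) * ‖u x‖ₑ ^ (q - 1) * ‖h x‖ₑ

/-- `V : (0, ∞) → [0, ∞]` is (Lebesgue) measurable and `V ∈ L^1((r₁, r₂))` for some
`r₂ > r₁ > 0`. Values of `V` outside `(0, ∞)` are irrelevant. -/
def AssumptionV (V : ℝ → ℝ≥0∞) : Prop :=
  AEMeasurable V (volume.restrict (Ioi 0)) ∧
    ∃ r₁ r₂ : ℝ, 0 < r₁ ∧ r₁ < r₂ ∧ ∫⁻ r in Ioo r₁ r₂, V r < ∞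

/-- `K : (0, ∞) → (0, ∞)` is (Lebesgue) measurable and `K ∈ L^s_loc((0, ∞))` for some
`s > 2N/(N+2)`. Values of `K` outside `(0, ∞)` are irrelevant. -/
def AssumptionK (N : ℕ) (K : ℝ → ℝ) : Prop :=
  (∀ r : ℝ, 0 < r → 0 < K r) ∧ AEMeasurable K (volume.restrict (Ioi 0)) ∧
    ∃ s : ℝ, 2 * (N : ℝ) / ((N : ℝ) + 2) < s ∧
      ∀ C : Set ℝ, IsCompact C → C ⊆ Ioi 0 →
        MemLp K (ENNReal.ofReal s) (volume.restrict C)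

/-- `q_*(α, β, γ)` in dimension `N`. -/
noncomputable def qStar (N : ℕ) (α β γ : ℝ) : ℝ :=
  2 * ((α - γ * β + N) / (N - γ))

/-- `q_{**}(α, β, γ)` in dimension `N`. -/
noncomputable def qStarStar (N : ℕ) (α β γ : ℝ) : ℝ :=
  2 * ((2 * α + (1 - 2 * β) * γ + 2 * ((N : ℝ) - 1)) / (2 * ((N : ℝ) - 1) - γ))

end RadialSobolev

/-!
For `r > R₂` the lower bound `V(r) ≳ r^{-γ}` gives `r^{N-1-γ/2} |u u'| ≲ r^{N-1} (u'² + V u²)`, so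
integrating `(u²)' = 2 u u'` from `|x|` to `∞` yields `|u(x)| ≲ |x|^{-ν} ‖u‖`, with
`ν = (2(N-1) - γ)/4`, for radial test functions; weighted `L²` convergence carries the bound over
to their closure. Then `K |u|^{q-1} |h| ≲ |x|^{-ε} (V u² + V h² + |x|^{-τ})` for some `ε > 0` and
`τ > N`: when `q ≥ 2`, spend `|u|^{q-2}` on the decay (which needs `q > q_{**}`) and bound `K` by a
multiple of a power of `|x|` times `V`; when `q < 2`, bound `K` with `V^{q/2}` instead and apply
Young's inequality with exponents `2/(q-1)`, `2`, `2/(2-q)` (which needs `q > q_*`).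
-/

namespace RadialSobolev

section PowerInequalities

lemma two_mul_mul_le_sq_add_sq (a b : ℝ≥0∞) : 2 * (a * b) ≤ a ^ 2 + b ^ 2 := by
  induction a <;> induction b <;> try simp
  rename_i a b
  rw [← mul_assoc]
  exact_mod_cast two_mul_le_add_sq a b

lemma mul_le_sq_add_sq (a b : ℝ≥0∞) : a * b ≤ a ^ 2 + b ^ 2 :=
  (le_mul_of_one_le_left' one_le_two).trans (two_mul_mul_le_sq_add_sq a b)

lemma add_sq_le_two_mul (a b : ℝ≥0∞) : (a + b) ^ 2 ≤ 2 * (a ^ 2 + b ^ 2) :=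
  calc (a + b) ^ 2 = a ^ 2 + b ^ 2 + 2 * (a * b) := by ring
    _ ≤ a ^ 2 + b ^ 2 + (a ^ 2 + b ^ 2) := by gcongr; exact two_mul_mul_le_sq_add_sq a b
    _ = 2 * (a ^ 2 + b ^ 2) := by ring

lemma enorm_sq_le_two_mul {F : Type*} [SeminormedAddCommGroup F] (a b : F) :
    ‖b‖ₑ ^ 2 ≤ 2 * (‖a‖ₑ ^ 2 + ‖a - b‖ₑ ^ 2) :=
  calc ‖b‖ₑ ^ 2 = ‖a - (a - b)‖ₑ ^ 2 := by rw [sub_sub_cancel]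
    _ ≤ (‖a‖ₑ + ‖a - b‖ₑ) ^ 2 := by gcongr; exact enorm_sub_le
    _ ≤ 2 * (‖a‖ₑ ^ 2 + ‖a - b‖ₑ ^ 2) := add_sq_le_two_mul _ _

lemma rpow_mul_mul_rpow_le_sq_add_sq_add_sq (a b t : ℝ≥0∞) {q : ℝ} (hq₁ : 1 ≤ q) (hq₂ : q ≤ 2) :
    a ^ (q - 1) * b * t ^ (2 - q) ≤ a ^ 2 + b ^ 2 + t ^ 2 := by
  set m := max a (max b t)
  have ham : a ≤ m := le_max_left _ _
  have hbm : b ≤ m := (le_max_left _ _).trans (le_max_right _ _)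
  have htm : t ≤ m := (le_max_right _ _).trans (le_max_right _ _)
  calc a ^ (q - 1) * b * t ^ (2 - q) ≤ m ^ (q - 1) * m ^ (1 : ℝ) * m ^ (2 - q) := by
        rw [ENNReal.rpow_one]
        gcongr
    _ = m ^ 2 := by
        rw [← ENNReal.rpow_add_of_nonneg _ _ (by linarith) zero_le_one,
          ← ENNReal.rpow_add_of_nonneg _ _ (by linarith) (by linarith), ← ENNReal.rpow_two]
        congr 1
        ring
    _ ≤ a ^ 2 + b ^ 2 + t ^ 2 := by
        rcases max_choice a (max b t) with h | h
        · rw [show m = a from h, add_assoc]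
          exact le_self_add
        rcases max_choice b t with h' | h'
        · rw [show m = b from h.trans h', add_right_comm]
          exact le_add_self
        · rw [show m = t from h.trans h']
          exact le_add_self

lemma rpow_half_sq (a : ℝ≥0∞) : (a ^ (1 / 2 : ℝ)) ^ 2 = a := by
  rw [← ENNReal.rpow_two, ← ENNReal.rpow_mul]
  norm_num

lemma rpow_sub_one_mul_self (a : ℝ≥0∞) {p : ℝ} (hp : 1 ≤ p) : a ^ (p - 1) * a = a ^ p := by
  nth_rw 2 [← ENNReal.rpow_one a]
  rw [← ENNReal.rpow_add_of_nonneg _ _ (sub_nonneg.2 hp) zero_le_one, sub_add_cancel]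

lemma one_le_rpow {a : ℝ≥0∞} (ha : 1 ≤ a) {p : ℝ} (hp : 0 ≤ p) : 1 ≤ a ^ p :=
  (ENNReal.one_rpow p).symm.trans_le (ENNReal.rpow_le_rpow ha hp)

lemma enorm_rpow_eq_ofReal {r : ℝ} (hr : 0 < r) (p : ℝ) : ‖r‖ₑ ^ p = ENNReal.ofReal (r ^ p) := by
  rw [Real.enorm_of_nonneg hr.le, ENNReal.ofReal_rpow_of_pos hr]

end PowerInequalities

section WeightedEstimates

variable {ρ v k a b A C D L : ℝ≥0∞} {α β γ σ ν ε τ p q n : ℝ}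

lemma rpow_le_of_one_le_mul (hρ₀ : ρ ≠ 0) (hρ : ρ ≠ ∞) (hp : 0 < p) (hβp : β ≤ p)
    (hv : 1 ≤ C * (ρ ^ γ * v)) : v ^ β ≤ C ^ (p - β) * ρ ^ (γ * (p - β)) * v ^ p := by
  have hCv : C * (ρ ^ γ * v) ≠ 0 := (one_pos.trans_le hv).ne'
  have hC₀ : C ≠ 0 := left_ne_zero_of_mul hCv
  have hv₀ : v ≠ 0 := right_ne_zero_of_mul (right_ne_zero_of_mul hCv)
  have hpβ : 0 ≤ p - β := sub_nonneg.2 hβp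
  by_cases hvt : v = ∞
  · have hC : C ^ (p - β) ≠ 0 := by simp [ENNReal.rpow_eq_zero_iff, hC₀, hpβ.not_gt]
    have hργ : ρ ^ (γ * (p - β)) ≠ 0 := (ENNReal.rpow_pos hρ₀.bot_lt hρ).ne'
    rw [hvt, ENNReal.top_rpow_of_pos hp, ENNReal.mul_top (mul_ne_zero hC hργ)]
    exact le_top
  · calc v ^ β ≤ v ^ β * (C * (ρ ^ γ * v)) ^ (p - β) :=
          le_mul_of_one_le_right' (one_le_rpow hv hpβ)
      _ = C ^ (p - β) * ρ ^ (γ * (p - β)) * (v ^ β * v ^ (p - β)) := by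
          rw [ENNReal.mul_rpow_of_nonneg _ _ hpβ, ENNReal.mul_rpow_of_nonneg _ _ hpβ,
            ENNReal.rpow_mul]
          ring
      _ = C ^ (p - β) * ρ ^ (γ * (p - β)) * v ^ p := by
          rw [← ENNReal.rpow_add _ _ hv₀ hvt, add_sub_cancel]

lemma kernel_le_rpow (hρ₀ : ρ ≠ 0) (hρ : ρ ≠ ∞) (hp : 0 < p) (hβp : β ≤ p)
    (hv : 1 ≤ C * (ρ ^ γ * v)) (hk : k ≤ L * (ρ ^ α * v ^ β)) :
    k ≤ L * C ^ (p - β) * ρ ^ (α + γ * (p - β)) * v ^ p :=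
  calc k ≤ L * (ρ ^ α * (C ^ (p - β) * ρ ^ (γ * (p - β)) * v ^ p)) := by
        grw [hk, rpow_le_of_one_le_mul hρ₀ hρ hp hβp hv]
    _ = L * C ^ (p - β) * ρ ^ (α + γ * (p - β)) * v ^ p := by
        rw [ENNReal.rpow_add _ _ hρ₀ hρ]
        ring

lemma integrand_le_of_two_le (hρ₀ : ρ ≠ 0) (hρ : ρ ≠ ∞) (hq : 2 ≤ q)
    (hk : k ≤ A * ρ ^ σ * v) (ha : a ≤ D * ρ ^ (-ν)) :
    k * a ^ (q - 1) * b ≤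
      A * D ^ (q - 2) * ρ ^ (-(ν * (q - 2) - σ)) * (v * a ^ 2 + v * b ^ 2) := by
  have hq₂ : 0 ≤ q - 2 := sub_nonneg.2 hq
  have ha_split : a ^ (q - 1) = a ^ (q - 2) * a := by
    rw [← rpow_sub_one_mul_self a (by linarith : 1 ≤ q - 1)]
    congr 2
    ring
  calc k * a ^ (q - 1) * b ≤ A * ρ ^ σ * v * ((D * ρ ^ (-ν)) ^ (q - 2) * a) * b := by
        rw [ha_split]
        gcongr
    _ = A * D ^ (q - 2) * (ρ ^ σ * ρ ^ (-ν * (q - 2))) * (v * (a * b)) := by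
        rw [ENNReal.mul_rpow_of_nonneg _ _ hq₂, ← ENNReal.rpow_mul]
        ring
    _ = A * D ^ (q - 2) * ρ ^ (-(ν * (q - 2) - σ)) * (v * (a * b)) := by
        rw [← ENNReal.rpow_add _ _ hρ₀ hρ]
        congr 3
        ring
    _ ≤ _ := by
        rw [← mul_add]
        gcongr
        exact mul_le_sq_add_sq a b

lemma integrand_le_of_le_two (hρ₀ : ρ ≠ 0) (hρ : ρ ≠ ∞) (hq₁ : 1 ≤ q) (hq₂ : q ≤ 2)
    (hτ : 2 * (σ + ε) = -τ * (2 - q)) (hk : k ≤ A * ρ ^ σ * v ^ (q / 2)) :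
    k * a ^ (q - 1) * b ≤ A * ρ ^ (-ε) * (v * a ^ 2 + v * b ^ 2 + ρ ^ (-τ)) := by
  set s := v ^ (1 / 2 : ℝ)
  set t := (ρ ^ (-τ)) ^ (1 / 2 : ℝ)
  have hv : v ^ (q / 2) = s ^ (q - 1) * s := by
    rw [rpow_sub_one_mul_self s hq₁, ← ENNReal.rpow_mul]
    congr 1
    ring
  have ht : ρ ^ σ = ρ ^ (-ε) * t ^ (2 - q) := by
    rw [← ENNReal.rpow_mul, ← ENNReal.rpow_mul, ← ENNReal.rpow_add _ _ hρ₀ hρ]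
    congr 1
    linarith
  calc k * a ^ (q - 1) * b ≤ A * ρ ^ σ * v ^ (q / 2) * a ^ (q - 1) * b := by gcongr
    _ = A * ρ ^ (-ε) * ((s * a) ^ (q - 1) * (s * b) * t ^ (2 - q)) := by
        rw [hv, ht, ENNReal.mul_rpow_of_nonneg _ _ (by linarith)]
        ring
    _ ≤ A * ρ ^ (-ε) * ((s * a) ^ 2 + (s * b) ^ 2 + t ^ 2) := by
        gcongr
        exact rpow_mul_mul_rpow_le_sq_add_sq_add_sq _ _ _ hq₁ hq₂
    _ = A * ρ ^ (-ε) * (v * a ^ 2 + v * b ^ 2 + ρ ^ (-τ)) := by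
        rw [mul_pow, mul_pow, rpow_half_sq, rpow_half_sq]

lemma rpow_sub_mul_mul_le (hρ₀ : ρ ≠ 0) (hρ : ρ ≠ ∞) (hv : 1 ≤ C * (ρ ^ γ * v)) :
    ρ ^ (n - γ / 2) * (2 * (a * b)) ≤ C ^ (1 / 2 : ℝ) * (ρ ^ n * (b ^ 2 + v * a ^ 2)) := by
  have hhalf : (0 : ℝ) ≤ 1 / 2 := by norm_num
  calc ρ ^ (n - γ / 2) * (2 * (a * b))
      ≤ ρ ^ (n - γ / 2) * (2 * (a * b)) * (C * (ρ ^ γ * v)) ^ (1 / 2 : ℝ) :=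
        le_mul_of_one_le_right' (one_le_rpow hv hhalf)
    _ = C ^ (1 / 2 : ℝ) * (ρ ^ (n - γ / 2) * ρ ^ (γ * (1 / 2)) *
          (2 * (b * (v ^ (1 / 2 : ℝ) * a)))) := by
        rw [ENNReal.mul_rpow_of_nonneg _ _ hhalf, ENNReal.mul_rpow_of_nonneg _ _ hhalf,
          ENNReal.rpow_mul]
        ring
    _ = C ^ (1 / 2 : ℝ) * (ρ ^ n * (2 * (b * (v ^ (1 / 2 : ℝ) * a)))) := by
        rw [← ENNReal.rpow_add _ _ hρ₀ hρ]
        congr 4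
        ring
    _ ≤ C ^ (1 / 2 : ℝ) * (ρ ^ n * (b ^ 2 + (v ^ (1 / 2 : ℝ) * a) ^ 2)) := by
        gcongr
        exact two_mul_mul_le_sq_add_sq _ _
    _ = C ^ (1 / 2 : ℝ) * (ρ ^ n * (b ^ 2 + v * a ^ 2)) := by rw [mul_pow, rpow_half_sq]

end WeightedEstimates

section Polar

variable {F : Type*} [NormedAddCommGroup F] [NormedSpace ℝ F] [FiniteDimensional ℝ F]
  [Nontrivial F] [MeasurableSpace F] [BorelSpace F] (μ : Measure F) [μ.IsAddHaarMeasure]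

lemma map_norm_eq_smul_withDensity :
    μ.map (‖·‖) = μ.toSphere univ •
      (volume.restrict (Ioi (0 : ℝ))).withDensity fun r => ‖r‖ₑ ^ (Module.finrank ℝ F - 1) := by
  have hpolar := μ.measurePreserving_homeomorphUnitSphereProd
  have hradius : Measure.map Subtype.val (Measure.volumeIoiPow (Module.finrank ℝ F - 1)) =
      (volume.restrict (Ioi (0 : ℝ))).withDensity fun r => ‖r‖ₑ ^ (Module.finrank ℝ F - 1) := by
    have hdensity (r : Ioi (0 : ℝ)) :
        ENNReal.ofReal (r.1 ^ (Module.finrank ℝ F - 1)) = ‖r.1‖ₑ ^ (Module.finrank ℝ F - 1) := by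
      rw [Real.enorm_of_nonneg r.2.le, ENNReal.ofReal_pow r.2.le]
    ext s hs
    rw [Measure.map_apply measurable_subtype_coe hs, Measure.volumeIoiPow,
      withDensity_apply _ (measurable_subtype_coe hs), withDensity_apply _ hs,
      ← map_comap_subtype_coe measurableSet_Ioi, setLIntegral_map hs (by fun_prop)
        measurable_subtype_coe]
    simp only [hdensity]
  calc μ.map (‖·‖) = (μ.restrict {0}ᶜ).map (‖·‖) := by rw [restrict_compl_singleton]
    _ = (μ.comap Subtype.val).map
          (Subtype.val ∘ Prod.snd ∘ homeomorphUnitSphereProd F) := by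
        rw [← map_comap_subtype_coe (measurableSet_singleton _).compl,
          Measure.map_map measurable_norm measurable_subtype_coe]
        congr 1
        ext x
        exact (homeomorphUnitSphereProd_apply_snd_coe F x).symm
    _ = (μ.toSphere univ • Measure.volumeIoiPow (Module.finrank ℝ F - 1)).map Subtype.val := by
        rw [← Measure.map_map measurable_subtype_coe
            (measurable_snd.comp hpolar.measurable),
          ← Measure.map_map measurable_snd hpolar.measurable, hpolar.map_eq,
          Measure.map_snd_prod]
    _ = _ := by rw [Measure.map_smul, hradius]

lemma lintegral_comp_norm {f : ℝ → ℝ≥0∞} (hf : AEMeasurable f (volume.restrict (Ioi 0))) :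
    ∫⁻ x, f ‖x‖ ∂μ =
      μ.toSphere univ * ∫⁻ r in Ioi 0, ‖r‖ₑ ^ (Module.finrank ℝ F - 1) * f r := by
  have hf_map : AEMeasurable f (μ.map (‖·‖)) := by
    rw [map_norm_eq_smul_withDensity]
    exact (hf.mono_ac (withDensity_absolutelyContinuous _ _)).smul_measure _
  rw [← lintegral_map' hf_map measurable_norm.aemeasurable, map_norm_eq_smul_withDensity,
    lintegral_smul_measure, lintegral_withDensity_eq_lintegral_mul₀ (by fun_prop) hf]
  rfl

lemma quasiMeasurePreserving_norm :
    Measure.QuasiMeasurePreserving (‖·‖) μ (volume.restrict (Ioi (0 : ℝ))) := by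
  refine ⟨measurable_norm, ?_⟩
  rw [map_norm_eq_smul_withDensity]
  exact (withDensity_absolutelyContinuous _ _).smul_left _

lemma ae_norm_of_ae_restrict_Ioi {R : ℝ} {p : ℝ → Prop}
    (hp : ∀ᵐ r ∂volume.restrict (Ioi R), p r) : ∀ᵐ x ∂μ, R < ‖x‖ → p ‖x‖ := by
  refine (quasiMeasurePreserving_norm μ).ae (p := fun r => R < r → p r) ?_
  rw [ae_restrict_iff' measurableSet_Ioi] at hp ⊢
  filter_upwards [hp] with r hr _ using hr

lemma setLIntegral_compl_ball_enorm_rpow_lt_top {τ R : ℝ} (hR : 0 < R)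
    (hτ : Module.finrank ℝ F < τ) : ∫⁻ x in (Metric.ball 0 R)ᶜ, ‖x‖ₑ ^ (-τ) ∂μ < ∞ := by
  have hradial : IntegrableOn (fun r : ℝ =>
      r ^ (Module.finrank ℝ F - 1) • (Ici R).indicator (fun s => s ^ (-τ)) r) (Ioi 0) := by
    have hpow : IntegrableOn (fun r : ℝ => r ^ ((Module.finrank ℝ F : ℝ) - 1 - τ)) (Ici R) := by
      rw [integrableOn_Ici_iff_integrableOn_Ioi]
      exact integrableOn_Ioi_rpow_of_lt (by linarith) hR
    refine ((integrable_indicator_iff measurableSet_Ici).2 hpow).integrableOn.congr_fun ?_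
      measurableSet_Ioi
    intro r hr
    by_cases hrR : r ∈ Ici R
    · simp only [indicator_of_mem hrR, smul_eq_mul]
      rw [← Real.rpow_natCast, ← Real.rpow_add hr, Nat.cast_pred Module.finrank_pos]
      congr 1
    · simp only [indicator_of_notMem hrR, smul_zero]
  have hfinite : ∫⁻ x, ‖(Ici R).indicator (fun s : ℝ => s ^ (-τ)) ‖x‖‖ₑ ∂μ < ∞ :=
    ((integrable_fun_norm_addHaar μ).2 hradial).hasFiniteIntegral
  refine hfinite.trans_eq' ?_
  rw [← lintegral_indicator measurableSet_ball.compl]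
  congr with x
  by_cases hx : ‖x‖ ∈ Ici R
  · have hx_ball : x ∈ (Metric.ball (0 : F) R)ᶜ := by simpa using hx
    rw [indicator_of_mem hx, indicator_of_mem hx_ball, ← enorm_norm x,
      enorm_rpow_eq_ofReal (hR.trans_le hx),
      Real.enorm_of_nonneg (Real.rpow_nonneg (norm_nonneg x) _)]
  · have hx_ball : x ∉ (Metric.ball (0 : F) R)ᶜ := by simpa using hx
    rw [indicator_of_notMem hx, indicator_of_notMem hx_ball, enorm_zero]

end Polar

section Profile

variable {f : ℝ → ℝ}

lemma enorm_sq_le_lintegral_Ioi (hf : ContDiff ℝ 1 f) (hf_supp : HasCompactSupport f) (r : ℝ) :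
    ‖f r‖ₑ ^ 2 ≤ ∫⁻ s in Ioi r, 2 * (‖f s‖ₑ * ‖deriv f s‖ₑ) := by
  have hsq_supp : HasCompactSupport (f ^ 2) := by
    simpa only [sq] using hf_supp.mul_right
  have hftc : ∫ s in Ioi r, deriv (f ^ 2) s = -f r ^ 2 :=
    hsq_supp.integral_Ioi_deriv_eq (hf.pow 2) r
  have hderiv (s : ℝ) : ‖deriv (f ^ 2) s‖ₑ = 2 * (‖f s‖ₑ * ‖deriv f s‖ₑ) := by
    rw [((hf.differentiable one_ne_zero s).hasDerivAt.pow 2).deriv]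
    simp [enorm_mul, Real.enorm_of_nonneg, mul_assoc]
  calc ‖f r‖ₑ ^ 2 = ‖∫ s in Ioi r, deriv (f ^ 2) s‖ₑ := by rw [hftc, enorm_neg, enorm_pow]
    _ ≤ ∫⁻ s in Ioi r, ‖deriv (f ^ 2) s‖ₑ := enorm_integral_le_lintegral_enorm _
    _ = ∫⁻ s in Ioi r, 2 * (‖f s‖ₑ * ‖deriv f s‖ₑ) := by simp only [hderiv]

lemma rpow_mul_enorm_sq_le_lintegral_Ioi (hf : ContDiff ℝ 1 f) (hf_supp : HasCompactSupport f)
    {V : ℝ → ℝ≥0∞} {C : ℝ≥0∞} {γ r : ℝ} {n : ℕ} (hr : 0 < r) (hC : C ≠ ∞) (hγ : γ ≤ 2 * n)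
    (hV : ∀ᵐ s ∂volume.restrict (Ioi r), 1 ≤ C * (‖s‖ₑ ^ γ * V s)) :
    ‖r‖ₑ ^ (n - γ / 2) * ‖f r‖ₑ ^ 2 ≤
      C ^ (1 / 2 : ℝ) * ∫⁻ s in Ioi r, ‖s‖ₑ ^ n * (‖deriv f s‖ₑ ^ 2 + V s * ‖f s‖ₑ ^ 2) := by
  have hexp : 0 ≤ n - γ / 2 := by linarith
  calc ‖r‖ₑ ^ (n - γ / 2) * ‖f r‖ₑ ^ 2
      ≤ ‖r‖ₑ ^ (n - γ / 2) * ∫⁻ s in Ioi r, 2 * (‖f s‖ₑ * ‖deriv f s‖ₑ) := by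
        grw [enorm_sq_le_lintegral_Ioi hf hf_supp r]
    _ = ∫⁻ s in Ioi r, ‖r‖ₑ ^ (n - γ / 2) * (2 * (‖f s‖ₑ * ‖deriv f s‖ₑ)) :=
        (lintegral_const_mul' _ _ (ENNReal.rpow_ne_top_of_nonneg hexp enorm_ne_top)).symm
    _ ≤ ∫⁻ s in Ioi r,
          C ^ (1 / 2 : ℝ) * (‖s‖ₑ ^ n * (‖deriv f s‖ₑ ^ 2 + V s * ‖f s‖ₑ ^ 2)) := by
        refine lintegral_mono_ae ?_
        filter_upwards [hV, ae_restrict_mem measurableSet_Ioi] with s hVs hrs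
        have hs : 0 < s := hr.trans hrs
        have hrs_enorm : ‖r‖ₑ ≤ ‖s‖ₑ := by
          rw [Real.enorm_of_nonneg hr.le, Real.enorm_of_nonneg hs.le]
          exact ENNReal.ofReal_le_ofReal (le_of_lt hrs)
        grw [hrs_enorm]
        rw [← ENNReal.rpow_natCast]
        exact rpow_sub_mul_mul_le (enorm_ne_zero.2 hs.ne') enorm_ne_top hVs
    _ = C ^ (1 / 2 : ℝ) * ∫⁻ s in Ioi r, ‖s‖ₑ ^ n * (‖deriv f s‖ₑ ^ 2 + V s * ‖f s‖ₑ ^ 2) :=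
        lintegral_const_mul' _ _ (ENNReal.rpow_ne_top_of_nonneg (by norm_num) hC)

end Profile

section WeakGradient

variable {N : ℕ} {V : ℝ → ℝ≥0∞} {u w φ : E N → ℝ} {G H : E N → E N}

lemma enorm_gradient (φ : E N → ℝ) (x : E N) : ‖gradient φ x‖ₑ = ‖fderiv ℝ φ x‖ₑ :=
  (InnerProductSpace.toDual ℝ (E N)).symm.enorm_map _

lemma IsTestFunction.differentiable (hφ : IsTestFunction φ) : Differentiable ℝ φ :=
  hφ.1.differentiable (by simp)

lemma IsTestFunction.continuous_fderiv (hφ : IsTestFunction φ) : Continuous (fderiv ℝ φ) :=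
  hφ.1.continuous_fderiv (by simp)

lemma IsTestFunction.continuous_fderiv_apply (hφ : IsTestFunction φ) (v : E N) :
    Continuous fun x => fderiv ℝ φ x v :=
  hφ.continuous_fderiv.clm_apply continuous_const

lemma IsTestFunction.hasWeakGradient (hφ : IsTestFunction φ) :
    HasWeakGradient φ (gradient φ) := by
  have hφ_cont : Continuous φ := hφ.1.continuous
  have hgradient : Continuous (gradient φ) :=
    (InnerProductSpace.toDual ℝ (E N)).symm.continuous.comp hφ.continuous_fderiv
  refine ⟨hφ_cont.locallyIntegrable, hgradient.locallyIntegrable, fun ψ hψ v => ?_⟩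
  have hψ_cont : Continuous ψ := hψ.1.continuous
  have hinner (x : E N) : inner ℝ (gradient φ x) v = fderiv ℝ φ x v := by simp [gradient]
  simp only [hinner]
  exact integral_mul_fderiv_eq_neg_fderiv_mul_of_integrable
    (((hφ.continuous_fderiv_apply v).mul hψ_cont).integrable_of_hasCompactSupport
      hψ.2.mul_left)
    ((hφ_cont.mul (hψ.continuous_fderiv_apply v)).integrable_of_hasCompactSupport
      hφ.2.mul_right)
    ((hφ_cont.mul hψ_cont).integrable_of_hasCompactSupport hφ.2.mul_right)
    (fun x _ => hφ.differentiable x) (fun x _ => hψ.differentiable x)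

lemma locallyIntegrable_inner_const (hG : LocallyIntegrable G volume) (v : E N) :
    LocallyIntegrable (fun x => inner ℝ (G x) v) volume := fun x =>
  let ⟨s, hs, hGs⟩ := hG x
  ⟨s, hs, hGs.inner_const v⟩

lemma HasWeakGradient.sub (hu : HasWeakGradient u G) (hw : HasWeakGradient w H) :
    HasWeakGradient (u - w) (G - H) := by
  refine ⟨hu.1.sub hw.1, hu.2.1.sub hw.2.1, fun φ hφ v => ?_⟩
  have integrable_mul {f g : E N → ℝ} (hf : LocallyIntegrable f volume) (hg : Continuous g)
      (hg_supp : HasCompactSupport g) : Integrable (fun x => f x * g x) :=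
    hf.integrable_smul_right_of_hasCompactSupport hg hg_supp
  have integrable_mul_fderiv {f : E N → ℝ} (hf : LocallyIntegrable f volume) :=
    integrable_mul hf (hφ.continuous_fderiv_apply v) (hφ.2.fderiv_apply ℝ v)
  have integrable_inner_mul {F : E N → E N} (hF : LocallyIntegrable F volume) :=
    integrable_mul (locallyIntegrable_inner_const hF v) hφ.1.continuous hφ.2
  simp only [Pi.sub_apply, sub_mul, inner_sub_left]
  rw [integral_sub (integrable_mul_fderiv hu.1) (integrable_mul_fderiv hw.1),
    integral_sub (integrable_inner_mul hu.2.1) (integrable_inner_mul hw.2.1),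
    hu.2.2 φ hφ v, hw.2.2 φ hφ v]
  ring

lemma HasWeakGradient.ae_eq (hG : HasWeakGradient u G) (hH : HasWeakGradient u H) :
    G =ᵐ[volume] H := by
  have hcoord (i : Fin N) : ∀ᵐ x, G x i = H x i := by
    have coord_eq_inner (F : E N → E N) (x : E N) :
        F x i = inner ℝ (F x) (EuclideanSpace.single i (1 : ℝ)) := by
      simp [EuclideanSpace.inner_single_right]
    simp only [coord_eq_inner G, coord_eq_inner H]
    refine ae_eq_of_integral_contDiff_smul_eq (locallyIntegrable_inner_const hG.2.1 _)
      (locallyIntegrable_inner_const hH.2.1 _) fun φ hφ hφ_supp => ?_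
    have hG_int := hG.2.2 φ ⟨hφ, hφ_supp⟩ (EuclideanSpace.single i 1)
    have hH_int := hH.2.2 φ ⟨hφ, hφ_supp⟩ (EuclideanSpace.single i 1)
    simp only [smul_eq_mul, mul_comm (φ _)]
    linarith
  filter_upwards [ae_all_iff.2 hcoord] with x hx
  ext i
  exact hx i

lemma HasWeakGradient.weakGradient_ae_eq (hG : HasWeakGradient u G) :
    weakGradient u =ᵐ[volume] G := by
  have hex : ∃ G, HasWeakGradient u G := ⟨G, hG⟩
  rw [weakGradient, dif_pos hex]
  exact hex.choose_spec.ae_eq hG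

lemma hNorm_sq (V : ℝ → ℝ≥0∞) (u : E N → ℝ) :
    hNorm V u ^ 2 = ∫⁻ x, (‖weakGradient u x‖ₑ ^ 2 + V ‖x‖ * ‖u x‖ₑ ^ 2) :=
  rpow_half_sq _

lemma HasWeakGradient.hNorm_sq (hG : HasWeakGradient u G) :
    hNorm V u ^ 2 = ∫⁻ x, (‖G x‖ₑ ^ 2 + V ‖x‖ * ‖u x‖ₑ ^ 2) := by
  rw [RadialSobolev.hNorm_sq]
  refine lintegral_congr_ae ?_
  filter_upwards [hG.weakGradient_ae_eq] with x hx
  rw [hx]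

lemma potentialEnergy_le_hNorm_sq (V : ℝ → ℝ≥0∞) (u : E N → ℝ) :
    potentialEnergy V u ≤ hNorm V u ^ 2 := by
  rw [hNorm_sq]
  exact lintegral_mono fun _ => le_add_self

lemma HasWeakGradient.hNorm_sq_le (hV : AEMeasurable (fun x : E N => V ‖x‖))
    (hu : HasWeakGradient u G) (hw : HasWeakGradient w H) :
    hNorm V w ^ 2 ≤ 2 * (hNorm V u ^ 2 + hNorm V (u - w) ^ 2) := by
  have hu_meas : AEMeasurable fun x => ‖G x‖ₑ ^ 2 + V ‖x‖ * ‖u x‖ₑ ^ 2 :=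
    (hu.2.1.aestronglyMeasurable.enorm.pow_const 2).add
      (hV.mul (hu.1.aestronglyMeasurable.enorm.pow_const 2))
  rw [hw.hNorm_sq, hu.hNorm_sq, (hu.sub hw).hNorm_sq, ← lintegral_add_left' hu_meas,
    ← lintegral_const_mul' _ _ (by simp)]
  refine lintegral_mono fun x => ?_
  grw [enorm_sq_le_two_mul (G x) (H x), enorm_sq_le_two_mul (u x) (w x)]
  exact le_of_eq (by simp only [Pi.sub_apply]; ring)

end WeakGradient

section RadialDecay

/-- The exponent `ν` in the Strauss-type bound `|u(x)| ≲ |x|^{-ν} ‖u‖` for radial functions when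
`V(r) ≳ r^{-γ}` at infinity. -/
noncomputable def decayExponent (N : ℕ) (γ : ℝ) : ℝ :=
  (2 * ((N : ℝ) - 1) - γ) / 4

variable {N : ℕ} {V : ℝ → ℝ≥0∞} {C : ℝ≥0∞} {γ R : ℝ} {φ : E N → ℝ} {e x : E N}

lemma IsRadial.apply_norm_smul (hφ : IsRadial φ) (he : ‖e‖ = 1) (x : E N) :
    φ (‖x‖ • e) = φ x :=
  hφ _ _ (by rw [norm_smul, norm_norm, he, mul_one])

lemma IsRadial.enorm_deriv_le (hφ : IsRadial φ) (he : ‖e‖ = 1) (hx : x ≠ 0)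
    (hφ_diff : DifferentiableAt ℝ φ x) :
    ‖deriv (fun s : ℝ => φ (s • e)) ‖x‖‖ₑ ≤ ‖gradient φ x‖ₑ := by
  set d := ‖x‖⁻¹ • x
  have hd : ‖d‖ = 1 := norm_smul_inv_norm hx
  have hxd : ‖x‖ • d = x := smul_inv_smul₀ (norm_ne_zero_iff.2 hx) x
  have hprofile : (fun s : ℝ => φ (s • e)) = fun s => φ (s • d) := by
    ext s
    exact hφ _ _ (by rw [norm_smul, norm_smul, he, hd])
  have hderiv : HasDerivAt (fun s : ℝ => φ (s • d)) (fderiv ℝ φ x d) ‖x‖ := by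
    have hray : HasDerivAt (fun s : ℝ => s • d) d ‖x‖ := by
      simpa using (hasDerivAt_id ‖x‖).smul_const d
    exact (hxd.symm ▸ hφ_diff.hasFDerivAt :
      HasFDerivAt φ (fderiv ℝ φ x) (‖x‖ • d)).comp_hasDerivAt _ hray
  have hd_enorm : ‖d‖ₑ = 1 := by rw [← enorm_norm, hd, enorm_one]
  rw [hprofile, hderiv.deriv, enorm_gradient]
  simpa [hd_enorm] using (fderiv ℝ φ x).le_opENorm d

lemma IsTestFunction.hasCompactSupport_profile (hφ : IsTestFunction φ) (he : ‖e‖ = 1) :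
    HasCompactSupport fun s : ℝ => φ (s • e) :=
  hφ.2.comp_isClosedEmbedding (isClosedEmbedding_smul_left (norm_ne_zero_iff.1 (by simp [he])))

lemma IsTestFunction.toSphere_mul_rpow_mul_enorm_sq_le [NeZero N]
    (hφ : IsTestFunction φ) (hφ_rad : IsRadial φ)
    (hV : AEMeasurable V (volume.restrict (Ioi 0))) (hC : C ≠ ∞) (hγ : γ ≤ 2 * ((N : ℝ) - 1))
    (hVC : ∀ᵐ r ∂volume.restrict (Ioi R), 1 ≤ C * (‖r‖ₑ ^ γ * V r))
    (hR : 0 ≤ R) (hx : R < ‖x‖) :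
    (volume : Measure (E N)).toSphere univ *
        (‖x‖ₑ ^ (2 * decayExponent N γ) * ‖φ x‖ₑ ^ 2) ≤ C ^ (1 / 2 : ℝ) * hNorm V φ ^ 2 := by
  have hx₀ : 0 < ‖x‖ := hR.trans_lt hx
  obtain ⟨e, he⟩ := exists_norm_eq (E N) zero_le_one
  set σ := (volume : Measure (E N)).toSphere univ
  set f : ℝ → ℝ := fun s => φ (s • e)
  set g : ℝ → ℝ≥0∞ := fun s => ‖deriv f s‖ₑ ^ 2 + V s * ‖f s‖ₑ ^ 2
  have hf : ContDiff ℝ 1 f := (hφ.1.of_le (by simp)).comp (by fun_prop)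
  have hg : AEMeasurable g (volume.restrict (Ioi 0)) := by
    have hf_cont : Continuous f := hf.continuous
    fun_prop
  have hf_norm (y : E N) : f ‖y‖ = φ y := hφ_rad.apply_norm_smul he y
  have hN_cast : ((N - 1 : ℕ) : ℝ) = N - 1 := Nat.cast_pred (NeZero.pos N)
  have hprofile := rpow_mul_enorm_sq_le_lintegral_Ioi hf (hφ.hasCompactSupport_profile he) hx₀ hC
    (hN_cast ▸ hγ) (ae_mono (Measure.restrict_mono_set _ (Ioi_subset_Ioi hx.le)) hVC)
  calc σ * (‖x‖ₑ ^ (2 * decayExponent N γ) * ‖φ x‖ₑ ^ 2)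
      = σ * (‖‖x‖‖ₑ ^ (((N - 1 : ℕ) : ℝ) - γ / 2) * ‖f ‖x‖‖ₑ ^ 2) := by
        rw [enorm_norm, hN_cast, hf_norm, decayExponent]
        congr 3
        ring
    _ ≤ σ * (C ^ (1 / 2 : ℝ) * ∫⁻ s in Ioi 0, ‖s‖ₑ ^ (N - 1) * g s) := by
        grw [hprofile, lintegral_mono_set (Ioi_subset_Ioi hx₀.le)]
    _ = C ^ (1 / 2 : ℝ) * ∫⁻ y : E N, g ‖y‖ := by
        rw [lintegral_comp_norm _ hg, finrank_euclideanSpace_fin]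
        ring
    _ ≤ C ^ (1 / 2 : ℝ) * hNorm V φ ^ 2 := by
        rw [hφ.hasWeakGradient.hNorm_sq]
        gcongr 1
        refine lintegral_mono_ae ?_
        filter_upwards [Measure.ae_ne volume 0] with y hy
        simp only [g, hf_norm]
        grw [hφ_rad.enorm_deriv_le he hy (hφ.differentiable y)]

lemma exists_enorm_le_rpow_mul_hNorm [NeZero N]
    (hV : AEMeasurable V (volume.restrict (Ioi 0))) (hC : C ≠ ∞) (hγ : γ ≤ 2 * ((N : ℝ) - 1))
    (hVC : ∀ᵐ r ∂volume.restrict (Ioi R), 1 ≤ C * (‖r‖ₑ ^ γ * V r)) (hR : 0 ≤ R) :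
    ∃ D : ℝ≥0∞, D ≠ ∞ ∧ ∀ φ : E N → ℝ, IsTestFunction φ → IsRadial φ → ∀ x : E N, R < ‖x‖ →
      ‖φ x‖ₑ ≤ D * ‖x‖ₑ ^ (-decayExponent N γ) * hNorm V φ := by
  set σ := (volume : Measure (E N)).toSphere univ
  have hσ₀ : σ ≠ 0 := by
    rw [Measure.measure_univ_ne_zero]
    exact Measure.toSphere_ne_zero _
  have hσ : σ ≠ ∞ := measure_ne_top _ _
  have hC_sqrt : C ^ (1 / 2 : ℝ) ≠ ∞ := ENNReal.rpow_ne_top_of_nonneg (by norm_num) hC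
  refine ⟨(σ⁻¹ * C ^ (1 / 2 : ℝ)) ^ (1 / 2 : ℝ), ENNReal.rpow_ne_top_of_nonneg (by norm_num)
    (ENNReal.mul_ne_top (ENNReal.inv_ne_top.2 hσ₀) hC_sqrt), fun φ hφ hφ_rad x hx => ?_⟩
  have hx₀ : ‖x‖ₑ ≠ 0 := enorm_ne_zero.2 (norm_pos_iff.1 (hR.trans_lt hx))
  set ν := decayExponent N γ
  have hcancel : ‖x‖ₑ ^ (-ν * 2) * ‖x‖ₑ ^ (2 * ν) = 1 := by
    rw [← ENNReal.rpow_add _ _ hx₀ enorm_ne_top, show -ν * 2 + 2 * ν = 0 by ring,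
      ENNReal.rpow_zero]
  refine (ENNReal.pow_le_pow_left_iff two_ne_zero).1 ?_
  calc ‖φ x‖ₑ ^ 2
      = σ⁻¹ * σ * (‖x‖ₑ ^ (-ν * 2) * ‖x‖ₑ ^ (2 * ν)) * ‖φ x‖ₑ ^ 2 := by
        rw [hcancel, ENNReal.inv_mul_cancel hσ₀ hσ, one_mul, one_mul]
    _ = σ⁻¹ * ‖x‖ₑ ^ (-ν * 2) * (σ * (‖x‖ₑ ^ (2 * ν) * ‖φ x‖ₑ ^ 2)) := by ring
    _ ≤ σ⁻¹ * ‖x‖ₑ ^ (-ν * 2) * (C ^ (1 / 2 : ℝ) * hNorm V φ ^ 2) := by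
        grw [hφ.toSphere_mul_rpow_mul_enorm_sq_le hφ_rad hV hC hγ hVC hR hx]
    _ = ((σ⁻¹ * C ^ (1 / 2 : ℝ)) ^ (1 / 2 : ℝ) * ‖x‖ₑ ^ (-ν) * hNorm V φ) ^ 2 := by
        rw [mul_pow, mul_pow, rpow_half_sq, ← ENNReal.rpow_mul_natCast, Nat.cast_ofNat]
        ring

end RadialDecay

section Closure

lemma ae_enorm_le_of_forall_approx {X F : Type*} [MeasurableSpace X] {μ : Measure X}
    [NormedAddCommGroup F] {w B : X → ℝ≥0∞} {u : X → F} (hw : AEMeasurable w μ)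
    (hw₀ : ∀ᵐ x ∂μ, w x ≠ 0) (hB : AEMeasurable B μ) (hu : AEStronglyMeasurable u μ)
    (happrox : ∀ ε : ℝ≥0∞, 0 < ε →
      ∃ φ : X → F, (∀ᵐ x ∂μ, ‖φ x‖ₑ ≤ B x) ∧ ∫⁻ x, w x * ‖u x - φ x‖ₑ ^ 2 ∂μ ≤ ε) :
    ∀ᵐ x ∂μ, ‖u x‖ₑ ≤ B x := by
  have hexcess : ∫⁻ x, w x * (‖u x‖ₑ - B x) ^ 2 ∂μ = 0 := by
    refine nonpos_iff_eq_zero.1 (le_of_forall_gt_imp_ge_of_dense fun ε hε => ?_)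
    obtain ⟨φ, hφB, hφ⟩ := happrox ε hε
    refine (lintegral_mono_ae ?_).trans hφ
    filter_upwards [hφB] with x hx
    gcongr
    calc ‖u x‖ₑ - B x ≤ ‖u x‖ₑ - ‖φ x‖ₑ := tsub_le_tsub_left hx _
      _ ≤ ‖u x - φ x‖ₑ := by
        rw [tsub_le_iff_right]
        simpa using enorm_add_le (u x - φ x) (φ x)
  have hexcess_meas : AEMeasurable (fun x => w x * (‖u x‖ₑ - B x) ^ 2) μ :=
    hw.mul ((hu.enorm.sub hB).pow_const 2)
  rw [lintegral_eq_zero_iff' hexcess_meas] at hexcess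
  filter_upwards [hexcess, hw₀] with x hx hwx
  have hx_sq : (‖u x‖ₑ - B x) ^ 2 = 0 := (mul_eq_zero.1 hx).resolve_left hwx
  exact tsub_eq_zero_iff_le.1 (pow_eq_zero_iff two_ne_zero |>.1 hx_sq)

variable {N : ℕ} {V : ℝ → ℝ≥0∞} {C : ℝ≥0∞} {γ R : ℝ} {u : E N → ℝ}

lemma aemeasurable_comp_norm [NeZero N] (hV : AEMeasurable V (volume.restrict (Ioi 0))) :
    AEMeasurable fun x : E N => V ‖x‖ :=
  hV.comp_quasiMeasurePreserving (quasiMeasurePreserving_norm volume)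

lemma MemHrad.exists_approx (hu : MemHrad V u) (hV : AEMeasurable fun x : E N => V ‖x‖)
    (hu_norm : hNorm V u = 1) {ε : ℝ≥0∞} (hε : 0 < ε) :
    ∃ φ : E N → ℝ, IsTestFunction φ ∧ IsRadial φ ∧ hNorm V φ ≤ 2 ∧
      potentialEnergy V (u - φ) ≤ ε := by
  obtain ⟨⟨⟨-, ⟨G, hG⟩, -⟩, -⟩, hclosure⟩ := hu
  obtain ⟨φ, hφ, hφ_rad, -, hdist⟩ := hclosure (min 1 ε) (lt_min one_pos hε)
  have hdist_one : hNorm V (u - φ) ≤ 1 := hdist.le.trans (min_le_left _ _)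
  refine ⟨φ, hφ, hφ_rad, (ENNReal.pow_le_pow_left_iff two_ne_zero).1 ?_, ?_⟩
  · calc hNorm V φ ^ 2 ≤ 2 * (hNorm V u ^ 2 + hNorm V (u - φ) ^ 2) :=
        hG.hNorm_sq_le hV hφ.hasWeakGradient
      _ ≤ 2 * (1 ^ 2 + 1 ^ 2) := by grw [hu_norm, hdist_one]
      _ = 2 ^ 2 := by norm_num
  · calc potentialEnergy V (u - φ) ≤ hNorm V (u - φ) ^ 2 := potentialEnergy_le_hNorm_sq _ _
      _ ≤ hNorm V (u - φ) := pow_le_of_le_one zero_le hdist_one two_ne_zero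
      _ ≤ ε := hdist.le.trans (min_le_right _ _)

lemma MemHrad.exists_ae_enorm_le_rpow [NeZero N]
    (hV : AEMeasurable V (volume.restrict (Ioi 0))) (hC : C ≠ ∞) (hγ : γ ≤ 2 * ((N : ℝ) - 1))
    (hVC : ∀ᵐ r ∂volume.restrict (Ioi R), 1 ≤ C * (‖r‖ₑ ^ γ * V r)) (hR : 0 ≤ R) :
    ∃ D : ℝ≥0∞, D ≠ ∞ ∧ ∀ u : E N → ℝ, MemHrad V u → hNorm V u = 1 →
      ∀ᵐ x, R < ‖x‖ → ‖u x‖ₑ ≤ D * ‖x‖ₑ ^ (-decayExponent N γ) := by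
  obtain ⟨D, hD, hdecay⟩ := exists_enorm_le_rpow_mul_hNorm hV hC hγ hVC hR
  refine ⟨D * 2, ENNReal.mul_ne_top hD (by simp), fun u hu hu_norm => ?_⟩
  have hV_norm : AEMeasurable fun x : E N => V ‖x‖ := aemeasurable_comp_norm hV
  have hexterior : MeasurableSet {x : E N | R < ‖x‖} :=
    measurableSet_lt measurable_const measurable_norm
  refine (ae_restrict_iff' hexterior).1 (ae_enorm_le_of_forall_approx hV_norm.restrict ?_ ?_
    hu.1.1.1.1.restrict fun ε hε => ?_)
  · refine (ae_restrict_iff' hexterior).2 ?_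
    filter_upwards [ae_norm_of_ae_restrict_Ioi volume hVC] with x hx hxR hVx
    simpa [hVx] using hx hxR
  · fun_prop
  · obtain ⟨φ, hφ, hφ_rad, hφ_norm, hφ_energy⟩ := hu.exists_approx hV_norm hu_norm hε
    refine ⟨φ, (ae_restrict_iff' hexterior).2 (Eventually.of_forall fun x hx => ?_),
      (setLIntegral_le_lintegral _ _).trans hφ_energy⟩
    grw [hdecay φ hφ hφ_rad x hx, hφ_norm]
    exact le_of_eq (by ring)

end Closure

section CriticalExponents

variable {N : ℕ} {α β γ q : ℝ}

lemma qStar_lt_iff (hγ : γ < N) :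
    qStar N α β γ < q ↔ α + γ * (q / 2 - β) < -(N * (1 - q / 2)) := by
  rw [qStar, ← mul_div_assoc, div_lt_iff₀ (by linarith)]
  constructor <;> intro h <;> linarith

lemma qStarStar_lt_iff (hγ : γ < 2 * ((N : ℝ) - 1)) :
    qStarStar N α β γ < q ↔ α + γ * (1 - β) < decayExponent N γ * (q - 2) := by
  rw [qStarStar, decayExponent, ← mul_div_assoc, div_lt_iff₀ (by linarith)]
  constructor <;> intro h <;> linarith

lemma exists_integrand_le {C L D : ℝ≥0∞} (hC : C ≠ ∞) (hL : L ≠ ∞) (hD : D ≠ ∞)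
    (hβ : β ≤ 1) (hγN : γ < N) (hγ : γ < 2 * ((N : ℝ) - 1)) (hq : 1 < q) (hβq : 2 * β < q)
    (hq_star : qStar N α β γ < q) (hq_starStar : qStarStar N α β γ < q) :
    ∃ (M : ℝ≥0∞) (ε τ : ℝ), M ≠ ∞ ∧ 0 < ε ∧ N < τ ∧ ∀ ρ v k a b : ℝ≥0∞, ρ ≠ 0 → ρ ≠ ∞ →
      1 ≤ C * (ρ ^ γ * v) → k ≤ L * (ρ ^ α * v ^ β) → a ≤ D * ρ ^ (-decayExponent N γ) →
      k * a ^ (q - 1) * b ≤ M * ρ ^ (-ε) * (v * a ^ 2 + v * b ^ 2 + ρ ^ (-τ)) := by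
  rw [qStar_lt_iff hγN] at hq_star
  rw [qStarStar_lt_iff hγ] at hq_starStar
  rcases le_or_gt 2 q with hq₂ | hq₂
  · refine ⟨L * C ^ (1 - β) * D ^ (q - 2),
      decayExponent N γ * (q - 2) - (α + γ * (1 - β)), N + 1, by finiteness, by linarith,
      by linarith, fun ρ v k a b hρ₀ hρ hv hk ha => ?_⟩
    have hkernel := kernel_le_rpow hρ₀ hρ one_pos hβ hv hk
    rw [ENNReal.rpow_one] at hkernel
    exact (integrand_le_of_two_le hρ₀ hρ hq₂ hkernel ha).trans
      (mul_le_mul_right le_self_add _)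
  · set σ := α + γ * (q / 2 - β)
    set ε := (-σ - N * (1 - q / 2)) / 2 with hε
    have hε_pos : 0 < ε := by linarith
    have hτ : 0 < 2 * ε / (2 - q) := div_pos (by linarith) (by linarith)
    refine ⟨L * C ^ (q / 2 - β), ε, N + 2 * ε / (2 - q),
      ENNReal.mul_ne_top hL (ENNReal.rpow_ne_top_of_nonneg (by linarith) hC), hε_pos, by linarith,
      fun ρ v k a b hρ₀ hρ hv hk _ => ?_⟩
    refine integrand_le_of_le_two hρ₀ hρ hq.le hq₂.le ?_
      (kernel_le_rpow hρ₀ hρ (by linarith) (by linarith) hv hk)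
    have hq_ne : 2 - q ≠ 0 := by linarith
    change 2 * (σ + ε) = _
    rw [neg_mul, add_mul, div_mul_cancel₀ _ hq_ne]
    linarith

end CriticalExponents

section EssentialBounds

lemma exists_ae_one_le_mul {X : Type*} [MeasurableSpace X] {μ : Measure X} {f : X → ℝ≥0∞}
    (hf : 0 < essInf f μ) : ∃ C : ℝ≥0∞, C ≠ ∞ ∧ ∀ᵐ x ∂μ, 1 ≤ C * f x := by
  have hmin₀ : min (essInf f μ) 1 ≠ 0 := (lt_min hf one_pos).ne'
  refine ⟨(min (essInf f μ) 1)⁻¹, ENNReal.inv_ne_top.2 hmin₀, ?_⟩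
  filter_upwards [ae_essInf_le (f := f)] with x hx
  calc 1 = (min (essInf f μ) 1)⁻¹ * min (essInf f μ) 1 :=
        (ENNReal.inv_mul_cancel hmin₀ (by simp)).symm
    _ ≤ (min (essInf f μ) 1)⁻¹ * f x := by
        gcongr
        exact (min_le_left _ _).trans hx

lemma exists_ae_le_mul {X : Type*} [MeasurableSpace X] {μ : Measure X} {f g : X → ℝ≥0∞}
    (hfg : essSup (fun x => f x / g x) μ < ∞) :
    ∃ L : ℝ≥0∞, L ≠ ∞ ∧ ∀ᵐ x ∂μ, f x ≤ L * g x := by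
  refine ⟨max (essSup (fun x => f x / g x) μ) 1, by simp [hfg.ne], ?_⟩
  filter_upwards [ENNReal.ae_le_essSup fun x => f x / g x] with x hx
  have hmax : f x / g x ≤ max (essSup (fun x => f x / g x) μ) 1 := hx.trans (le_max_left _ _)
  refine (ENNReal.div_le_iff_le_mul (Or.inr ?_) (Or.inr ?_)).1 hmax
  · simp [hfg.ne]
  · simp

end EssentialBounds

section Tail

variable {N : ℕ} {V : ℝ → ℝ≥0∞} {K : ℝ → ℝ} {α β γ q R R₂ : ℝ}

lemma enorm_rpow_neg_le {F : Type*} [NormedAddCommGroup F] {x : F} {ε : ℝ} (hε : 0 ≤ ε)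
    (hR : 0 ≤ R) (hx : R ≤ ‖x‖) : ‖x‖ₑ ^ (-ε) ≤ ‖R‖ₑ ^ (-ε) := by
  have hRx : ‖R‖ₑ ≤ ‖x‖ₑ := by rwa [enorm_le_iff_norm_le, Real.norm_of_nonneg hR]
  rw [ENNReal.rpow_neg, ENNReal.rpow_neg]
  gcongr

lemma setLIntegral_compl_ball_le {k : E N → ℝ≥0∞} {A : ℝ≥0∞} {τ : ℝ} {u h : E N → ℝ}
    (hV : AEMeasurable fun x : E N => V ‖x‖) (hu : AEStronglyMeasurable u)
    (hh : AEStronglyMeasurable h) (hA : A ≠ ∞)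
    (hk : ∀ᵐ x, R ≤ ‖x‖ →
      k x ≤ A * (V ‖x‖ * ‖u x‖ₑ ^ 2 + V ‖x‖ * ‖h x‖ₑ ^ 2 + ‖x‖ₑ ^ (-τ))) :
    ∫⁻ x in (Metric.ball 0 R)ᶜ, k x ≤ A * (potentialEnergy V u + potentialEnergy V h +
      ∫⁻ x in (Metric.ball (0 : E N) R)ᶜ, ‖x‖ₑ ^ (-τ)) := by
  have henergy {w : E N → ℝ} (hw : AEStronglyMeasurable w) :
      AEMeasurable fun x => V ‖x‖ * ‖w x‖ₑ ^ 2 := hV.mul (hw.enorm.pow_const 2)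
  calc ∫⁻ x in (Metric.ball 0 R)ᶜ, k x
      ≤ ∫⁻ x in (Metric.ball 0 R)ᶜ,
          A * (V ‖x‖ * ‖u x‖ₑ ^ 2 + V ‖x‖ * ‖h x‖ₑ ^ 2 + ‖x‖ₑ ^ (-τ)) := by
        refine setLIntegral_mono_ae' measurableSet_ball.compl ?_
        filter_upwards [hk] with x hx hxR
        exact hx (by simpa using hxR)
    _ = A * ((∫⁻ x in (Metric.ball 0 R)ᶜ, V ‖x‖ * ‖u x‖ₑ ^ 2) +
          (∫⁻ x in (Metric.ball 0 R)ᶜ, V ‖x‖ * ‖h x‖ₑ ^ 2) +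
          ∫⁻ x in (Metric.ball (0 : E N) R)ᶜ, ‖x‖ₑ ^ (-τ)) := by
        rw [lintegral_const_mul' _ _ hA,
          lintegral_add_left' ((henergy hu).fun_add (henergy hh)).restrict,
          lintegral_add_left' (henergy hu).restrict]
    _ ≤ _ := by
        gcongr <;> exact setLIntegral_le_lintegral _ _

lemma exists_Rinfty_le [NeZero N] (hV : AEMeasurable V (volume.restrict (Ioi 0)))
    {C L : ℝ≥0∞} (hC : C ≠ ∞) (hL : L ≠ ∞) (hR₂ : 0 < R₂)
    (hVC : ∀ᵐ r ∂volume.restrict (Ioi R₂), 1 ≤ C * (‖r‖ₑ ^ γ * V r))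
    (hKL : ∀ᵐ r ∂volume.restrict (Ioi R₂), ENNReal.ofReal (K r) ≤ L * (‖r‖ₑ ^ α * V r ^ β))
    (hβ : β ≤ 1) (hγN : γ < N) (hγ : γ < 2 * ((N : ℝ) - 1)) (hq : 1 < q) (hβq : 2 * β < q)
    (hq_star : qStar N α β γ < q) (hq_starStar : qStarStar N α β γ < q) :
    ∃ (B : ℝ≥0∞) (ε : ℝ), B ≠ ∞ ∧ 0 < ε ∧ ∀ R > R₂, Rinfty N V K q R ≤ B * ‖R‖ₑ ^ (-ε) := by
  obtain ⟨D, hD, hdecay⟩ := MemHrad.exists_ae_enorm_le_rpow hV hC hγ.le hVC hR₂.le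
  obtain ⟨M, ε, τ, hM, hε, hτ, hpointwise⟩ :=
    exists_integrand_le hC hL hD hβ hγN hγ hq hβq hq_star hq_starStar
  set T := ∫⁻ x in (Metric.ball (0 : E N) R₂)ᶜ, ‖x‖ₑ ^ (-τ)
  have hT : T < ∞ := setLIntegral_compl_ball_enorm_rpow_lt_top volume hR₂ (by simpa using hτ)
  refine ⟨M * (1 + 1 + T), ε, by finiteness, hε, fun R hR => ?_⟩
  have hR₀ : 0 < R := hR₂.trans hR
  simp only [Rinfty, iSup_le_iff]
  intro u h hu hh hu_norm hh_norm
  have henergy {w : E N → ℝ} (hw : hNorm V w = 1) : potentialEnergy V w ≤ 1 :=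
    (potentialEnergy_le_hNorm_sq V w).trans_eq (by rw [hw, one_pow])
  have hA : M * ‖R‖ₑ ^ (-ε) ≠ ∞ := by
    rw [enorm_rpow_eq_ofReal hR₀]
    finiteness
  calc ∫⁻ x in (Metric.ball (0 : E N) R)ᶜ,
        ENNReal.ofReal (K ‖x‖) * ‖u x‖ₑ ^ (q - 1) * ‖h x‖ₑ
      ≤ M * ‖R‖ₑ ^ (-ε) * (potentialEnergy V u + potentialEnergy V h +
          ∫⁻ x in (Metric.ball (0 : E N) R)ᶜ, ‖x‖ₑ ^ (-τ)) := by
        refine setLIntegral_compl_ball_le (aemeasurable_comp_norm hV) hu.1.1.1.1 hh.1.1.1 hA ?_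
        filter_upwards [ae_norm_of_ae_restrict_Ioi volume hVC,
          ae_norm_of_ae_restrict_Ioi volume hKL, hdecay u hu hu_norm] with x hVx hKx hux hRx
        have hx : R₂ < ‖x‖ := hR.trans_le hRx
        have hx₀ : ‖x‖ₑ ≠ 0 := enorm_ne_zero.2 (norm_pos_iff.1 (hR₂.trans hx))
        simp only [enorm_norm] at hVx hKx
        grw [hpointwise _ _ _ _ _ hx₀ enorm_ne_top (hVx hx) (hKx hx) (hux hx),
          enorm_rpow_neg_le hε.le hR₀.le hRx]
    _ ≤ M * ‖R‖ₑ ^ (-ε) * (1 + 1 + T) := by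
        grw [henergy hu_norm, henergy hh_norm,
          lintegral_mono_set (compl_subset_compl.2 (Metric.ball_subset_ball hR.le))]
    _ = M * (1 + 1 + T) * ‖R‖ₑ ^ (-ε) := by ring

lemma tendsto_mul_enorm_rpow_neg_atTop {B : ℝ≥0∞} (hB : B ≠ ∞) {ε : ℝ} (hε : 0 < ε) :
    Tendsto (fun R : ℝ => B * ‖R‖ₑ ^ (-ε)) atTop (𝓝 0) := by
  have hpow : Tendsto (fun R : ℝ => ‖R‖ₑ ^ (-ε)) atTop (𝓝 0) := by
    refine (ENNReal.ofReal_zero ▸ ENNReal.tendsto_ofReal (tendsto_rpow_neg_atTop hε)).congr' ?_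
    filter_upwards [eventually_gt_atTop 0] with R hR
    exact (enorm_rpow_eq_ofReal hR _).symm
  simpa using ENNReal.Tendsto.const_mul hpow (Or.inr hB)

end Tail

end RadialSobolev

open RadialSobolev in
theorem theorem2p5_general (N : ℕ) (hN : 3 ≤ N) (V : ℝ → ℝ≥0∞) (K : ℝ → ℝ)
    (hV : AEMeasurable V (volume.restrict (Ioi 0))) (R₂ : ℝ) (hR₂ : 0 < R₂) (α β γ : ℝ)
    (hβ : β ≤ 1) (hγ : γ < N)
    (hsup : essSup (fun r : ℝ => ENNReal.ofReal (K r) / (ENNReal.ofReal (r ^ α) * V r ^ β))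
      (volume.restrict (Ioi R₂)) < ∞)
    (hinf : 0 < essInf (fun r : ℝ => ENNReal.ofReal (r ^ γ) * V r) (volume.restrict (Ioi R₂)))
    (q : ℝ) (hq : max 1 (max (2 * β) (max (qStar N α β γ) (qStarStar N α β γ))) < q) :
    Tendsto (fun R : ℝ => Rinfty N V K q R) atTop (𝓝 0) := by
  have : NeZero N := ⟨by omega⟩
  have hN_cast : (3 : ℝ) ≤ N := by exact_mod_cast hN
  simp only [max_lt_iff] at hq
  obtain ⟨hq₁, hβq, hq_star, hq_starStar⟩ := hq
  have hpow (σ : ℝ) : ∀ᵐ r ∂volume.restrict (Ioi R₂), ENNReal.ofReal (r ^ σ) = ‖r‖ₑ ^ σ :=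
    (ae_restrict_mem measurableSet_Ioi).mono fun r hr =>
      (enorm_rpow_eq_ofReal (hR₂.trans hr) σ).symm
  obtain ⟨C, hC, hVC⟩ := exists_ae_one_le_mul hinf
  obtain ⟨L, hL, hKL⟩ := exists_ae_le_mul hsup
  obtain ⟨B, ε, hB, hε, hbound⟩ := exists_Rinfty_le hV hC hL hR₂
    ((hpow γ).mp (hVC.mono fun r hr h => h ▸ hr)) ((hpow α).mp (hKL.mono fun r hr h => h ▸ hr))
    hβ hγ (by linarith) hq₁ hβq hq_star hq_starStar
  exact tendsto_of_tendsto_of_tendsto_of_le_of_le' tendsto_const_nhds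
    (tendsto_mul_enorm_rpow_neg_atTop hB hε) (Eventually.of_forall fun _ => zero_le)
    ((eventually_gt_atTop R₂).mono hbound)

theorem theorem2p5 (N : ℕ) (hN : 3 ≤ N) (V : ℝ → ℝ≥0∞) (K : ℝ → ℝ)
    (hV : RadialSobolev.AssumptionV V) (hK : RadialSobolev.AssumptionK N K)
    (hVfin : ∀ᵐ r ∂(volume.restrict (Ioi (0 : ℝ))), V r < ∞)
    (R₂ : ℝ) (hR₂ : 0 < R₂) (α β γ : ℝ) (hβ₀ : 0 ≤ β) (hβ₁ : β ≤ 1) (hγ : γ ≤ 2)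
    (hsup : essSup (fun r : ℝ => ENNReal.ofReal (K r) / (ENNReal.ofReal (r ^ α) * V r ^ β))
      (volume.restrict (Ioi R₂)) < ∞)
    (hinf : 0 < essInf (fun r : ℝ => ENNReal.ofReal (r ^ γ) * V r)
      (volume.restrict (Ioi R₂)))
    (q₂ : ℝ)
    (hq₂ : max 1 (max (2 * β)
      (max (RadialSobolev.qStar N α β γ) (RadialSobolev.qStarStar N α β γ))) < q₂) :
    Tendsto (fun R : ℝ => RadialSobolev.Rinfty N V K q₂ R) atTop (𝓝 0) :=
  theorem2p5_general N hN V K hV.1 R₂ hR₂ α β γ hβ₁ (hγ.trans_lt (by exact_mod_cast hN))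
    hsup hinf q₂ hq₂
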